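/- For $\alpha\in\mathbb{C}$ and $n\ge 0$ let $L_n^{(\alpha)}(z)=\frac{z^{-\alpha}e^z}{n!}\frac{d^n}{dz^n}\left(z^{n+\alpha}e^{-z}\right)=\sum_{i=0}^n(-1)^i\binom{n+\alpha}{n-i}\frac{z^i}{i!}$ be the associated Laguerre polynomial. For integers $m,n\ge 0$ and $\mu\in\mathbb{C}$ put $$T_{m,n}^{(\mu)}(z)=\det\left[\frac{d^{j+k}}{dz^{j+k}}L_{m+n}^{(\mu+1)}(z)\right]_{j,k=0}^{n-1},\qquad \widehat T_{m,n}^{(\mu)}(z)=\det\left[\frac{d^{j+k}}{dz^{j+k}}L_{m+n}^{(\mu+1)}(-z)\right]_{j,k=0}^{n-1},$$ where the empty determinant ($n=0$) equals $1$. Let $\mathrm{S}_{\mathrm V}$ with parameters $(\nu_1,\nu_2,\nu_3)$ be the Painlevé V $\sigma$-equation $$\left(z\frac{d^2\sigma}{dz^2}\right)^{2}=\left[2\left(\frac{d\sigma}{dz}\right)^{2}+(\nu_1+\nu_2+\nu_3-z)\frac{d\sigma}{dz}+\sigma\right]^2-4\frac{d\sigma}{dz}\prod_{j=1}^3\left(\frac{d\sigma}{dz}+\nu_j\right).$$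 **Lemma (Non-uniqueness for $\mathrm{S}_{\mathrm V}$).** Let $m\ge 0$, $n\ge 1$ and $k\ge -n$ be integers (so that $\mu=k\in\mathbb{Z}$, $\mu\ge -n$). Then the polynomials $T_{m,n}^{(k)}$, $\widehat T_{m,n}^{(k)}$, $T_{m,n+k}^{(-k)}$, $\widehat T_{m,n+k}^{(-k)}$ are not identically zero, and: 1. The rational functions $$z\frac{d}{dz}\ln T_{m,n}^{(k)}(z)-(m+1)n\qquad\text{and}\qquad z\frac{d}{dz}\ln\widehat T_{m,n+k}^{(-k)}(z)-(m+1)z-(m+1)n$$ are two distinct rational solutions of $\mathrm{S}_{\mathrm V}$ for the same parameters $(\nu_1,\nu_2,\nu_3)=(m+1,\,-n,\,m+n+k+1)$. 2. The rational functions $$z\frac{d}{dz}\ln\widehat T_{m,n}^{(k)}(z)-(m+1)n\qquad\text{and}\qquad z\frac{d}{dz}\ln T_{m,n+k}^{(-k)}(z)+(m+1)z-(m+1)n$$ are two distinct rational solutions of $\mathrm{S}_{\mathrm V}$ for the same parameters $(\nu_1,\nu_2,\nu_3)=(-m-1,\,n,\,-m-n-k-1)$. -/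

import Mathlib

open Polynomial

namespace PainleveV

/-- The associated Laguerre polynomial
`L_n^{(α)}(z) = ∑_{i=0}^n (-1)^i binom(n+α, n-i) z^i / i!`, as a polynomial in `z`, for every
complex `α`. The generalised binomial coefficient `binom(n+α, n-i)` is the falling factorial
`(n+α)(n+α-1)⋯(α+i+1)` divided by `(n-i)!`. See `eval_laguerre` for Rodrigues' formula. -/
noncomputable def laguerre (n : ℕ) (α : ℂ) : ℂ[X] :=
  ∑ i ∈ Finset.range (n + 1),
    C ((-1) ^ i * ((descPochhammer ℂ (n - i)).eval ((n : ℂ) + α) / ((n - i).factorial : ℂ))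
      / (i.factorial : ℂ)) * X ^ i

/-- The generalised Laguerre polynomial
`T_{m,n}^{(μ)}(z) = det [ d^{j+k}/dz^{j+k} L_{m+n}^{(μ+1)}(z) ]_{j,k=0}^{n-1}`.
For `n = 0` the determinant is empty and equals `1`. -/
noncomputable def genLaguerre (m n : ℕ) (μ : ℂ) : ℂ[X] :=
  Matrix.det (Matrix.of fun j k : Fin n =>
    derivative^[(j : ℕ) + (k : ℕ)] (laguerre (m + n) (μ + 1)))

/-- The polynomial
`\hat T_{m,n}^{(μ)}(z) = det [ d^{j+k}/dz^{j+k} (L_{m+n}^{(μ+1)}(-z)) ]_{j,k=0}^{n-1}`.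
For `n = 0` the determinant is empty and equals `1`. -/
noncomputable def genLaguerreHat (m n : ℕ) (μ : ℂ) : ℂ[X] :=
  Matrix.det (Matrix.of fun j k : Fin n =>
    derivative^[(j : ℕ) + (k : ℕ)] ((laguerre (m + n) (μ + 1)).comp (-X)))

/-- The derivative `d/dz` of a rational function, by the quotient rule. See `hasDerivAt_eval`. -/
noncomputable def ratDeriv (f : RatFunc ℂ) : RatFunc ℂ :=
  (algebraMap ℂ[X] (RatFunc ℂ) (derivative f.num) * algebraMap ℂ[X] (RatFunc ℂ) f.denom
      - algebraMap ℂ[X] (RatFunc ℂ) f.num * algebraMap ℂ[X] (RatFunc ℂ) (derivative f.denom))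
    / algebraMap ℂ[X] (RatFunc ℂ) f.denom ^ 2

/-- `z d/dz ln P(z) = z P'(z) / P(z)` for a nonzero polynomial `P`, as a rational function. -/
noncomputable def zLogDeriv (P : ℂ[X]) : RatFunc ℂ :=
  RatFunc.X * (ratDeriv (algebraMap ℂ[X] (RatFunc ℂ) P) / algebraMap ℂ[X] (RatFunc ℂ) P)

/-- The rational function `σ` solves the Painlevé V `σ`-equation `S_V` with parameters
`(ν₁, ν₂, ν₃)`:
`(z σ'')² = [2 (σ')² + (ν₁ + ν₂ + ν₃ - z) σ' + σ]² - 4 σ' (σ' + ν₁) (σ' + ν₂) (σ' + ν₃)`. -/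
def IsRationalSolutionSV (ν₁ ν₂ ν₃ : ℂ) (σ : RatFunc ℂ) : Prop :=
  (RatFunc.X * ratDeriv (ratDeriv σ)) ^ 2 =
    (2 * ratDeriv σ ^ 2 + (RatFunc.C (ν₁ + ν₂ + ν₃) - RatFunc.X) * ratDeriv σ + σ) ^ 2
      - 4 * ratDeriv σ * ((ratDeriv σ + RatFunc.C ν₁) * (ratDeriv σ + RatFunc.C ν₂)
        * (ratDeriv σ + RatFunc.C ν₃))

/-- `ratDeriv f` is the derivative of `f` as a function, away from the poles of `f`. -/
theorem hasDerivAt_eval (f : RatFunc ℂ) (z : ℂ) (hz : f.denom.eval z ≠ 0) :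
    HasDerivAt (fun w => f.eval (RingHom.id ℂ) w) ((ratDeriv f).eval (RingHom.id ℂ) z) z := by
  have key : ∀ p q : ℂ[X], q.eval z ≠ 0 →
      (algebraMap ℂ[X] (RatFunc ℂ) p / algebraMap ℂ[X] (RatFunc ℂ) q).eval (RingHom.id ℂ) z
        = p.eval z / q.eval z := by
    intro p q hq
    have hq0 : q ≠ 0 := by rintro rfl; simp at hq
    have hd : (algebraMap ℂ[X] (RatFunc ℂ) p / algebraMap ℂ[X] (RatFunc ℂ) q).denom.eval z ≠ 0 := by
      intro h0
      obtain ⟨c, hc⟩ := RatFunc.denom_div_dvd p q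
      apply hq
      rw [hc, eval_mul, h0, zero_mul]
    have h := RatFunc.num_div_denom
      (algebraMap ℂ[X] (RatFunc ℂ) p / algebraMap ℂ[X] (RatFunc ℂ) q)
    rw [div_eq_div_iff (by simpa using RatFunc.denom_ne_zero _) (by simpa using hq0),
      ← map_mul, ← map_mul] at h
    have h2 := congrArg (Polynomial.eval z) (RatFunc.algebraMap_injective ℂ h)
    rw [eval_mul, eval_mul] at h2
    rw [RatFunc.eval, eval₂_id, eval₂_id, div_eq_div_iff hd hq, h2]
  have h1 : (ratDeriv f).eval (RingHom.id ℂ) z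
      = ((derivative f.num).eval z * f.denom.eval z - f.num.eval z * (derivative f.denom).eval z)
        / f.denom.eval z ^ 2 := by
    have := key (derivative f.num * f.denom - f.num * derivative f.denom) (f.denom ^ 2)
      (by simpa using hz)
    simpa [ratDeriv] using this
  rw [h1]
  have h2 := (f.num.hasDerivAt z).div (f.denom.hasDerivAt z) hz
  simpa [RatFunc.eval, eval₂_id, Pi.div_def] using h2

/-- Rodrigues' formula `L_n^{(α)}(z) = z^{-α} e^z / n! * dⁿ/dzⁿ (z^{n+α} e^{-z})`. -/
theorem eval_laguerre (n : ℕ) (α z : ℂ) (hz : z ∈ Complex.slitPlane) :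
    (laguerre n α).eval z = z ^ (-α) * Complex.exp z / (n.factorial : ℂ)
      * iteratedDeriv n (fun w : ℂ => w ^ ((n : ℂ) + α) * Complex.exp (-w)) z := by
  have hz0 : z ≠ 0 := Complex.slitPlane_ne_zero hz
  have hpow : ∀ (i : ℕ) (β w : ℂ), w ∈ Complex.slitPlane →
      iteratedDeriv i (fun w : ℂ => w ^ β) w
        = (descPochhammer ℂ i).eval β * w ^ (β - i) := by
    intro i β
    induction i with
    | zero => intro w _; simp
    | succ i ih =>
      intro w hw
      rw [iteratedDeriv_succ]
      have he : iteratedDeriv i (fun w : ℂ => w ^ β) =ᶠ[nhds w]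
          fun w => (descPochhammer ℂ i).eval β * w ^ (β - i) := by
        filter_upwards [Complex.isOpen_slitPlane.mem_nhds hw] with v hv using ih v hv
      rw [he.deriv_eq]
      have hd := ((hasDerivAt_id w).cpow_const (c := β - i) hw).const_mul
        ((descPochhammer ℂ i).eval β)
      have := hd.deriv
      simp only [id] at this
      rw [this, descPochhammer_succ_eval]
      push_cast
      rw [show β - ((i : ℂ) + 1) = β - i - 1 by ring]
      ring
  have hexp : ∀ (i : ℕ), iteratedDeriv i (fun w : ℂ => Complex.exp (-w)) z
      = (-1) ^ i * Complex.exp (-z) := by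
    intro i
    have := congrFun (iteratedDeriv_cexp_const_mul i (-1)) z
    simpa using this
  have hc1 : ContDiffAt ℂ n (fun w : ℂ => w ^ ((n : ℂ) + α)) z :=
    (analyticAt_id.cpow analyticAt_const hz).contDiffAt
  have hc2 : ContDiffAt ℂ n (fun w : ℂ => Complex.exp (-w)) z := by fun_prop
  have hL := iteratedDeriv_mul hc1 hc2
  have hfun : ((fun w : ℂ => w ^ ((n : ℂ) + α)) * fun w : ℂ => Complex.exp (-w))
      = fun w : ℂ => w ^ ((n : ℂ) + α) * Complex.exp (-w) := rfl
  rw [hfun] at hL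
  rw [hL, laguerre, eval_finsetSum, Finset.mul_sum, ← Finset.sum_range_reflect]
  refine Finset.sum_congr rfl fun i hi => ?_
  have hin : i ≤ n := Nat.lt_succ_iff.mp (Finset.mem_range.mp hi)
  rw [hpow _ _ _ hz, hexp, show n + 1 - 1 - i = n - i by omega, Nat.sub_sub_self hin]
  have hz1 : z ^ ((n : ℂ) + α - i) = z ^ α * z ^ (n - i) := by
    rw [← Complex.cpow_natCast, ← Complex.cpow_add _ _ hz0, Nat.cast_sub hin]
    congr 1
    ring
  have hch : (n.choose i : ℂ) = n.factorial / (i.factorial * (n - i).factorial) :=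
    Nat.cast_choose ℂ hin
  have hza : z ^ α ≠ 0 := by simp [Complex.cpow_eq_zero_iff, hz0]
  have h1 : (n.factorial : ℂ) ≠ 0 := by exact_mod_cast n.factorial_ne_zero
  have h2 : (i.factorial : ℂ) ≠ 0 := by exact_mod_cast i.factorial_ne_zero
  have h3 : ((n - i).factorial : ℂ) ≠ 0 := by exact_mod_cast (n - i).factorial_ne_zero
  have h4 := Complex.exp_ne_zero z
  rw [hz1, hch, Complex.cpow_neg, Complex.exp_neg]
  simp only [eval_mul, eval_C, eval_pow, eval_X]
  field_simp

end PainleveV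

/-! Let `f` be the Laguerre polynomial of degree `N = m + n`, `τ_n` the Hankel determinant of its
derivatives and `h_n = τ_n'/τ_n`. The Toda equation says `h_{n+1}' = τ_{n+2} τ_n / τ_{n+1}²`, and
the Laguerre equation is a Riccati equation for `h_1`. With `R_n = z(h_{n+1} - h_n) - z + 2n + a + b
+ 1` and `r_n = (z h_n)' - n`, a Riccati equation for `R_n` and two factorised equations propagate
along the chain (`factorised_chain`). Eliminating `R_n` between the latter leaves the `σ`-equation
(`sigma_equation_of_factorised`); `a = -(N+1)` and `b = N + μ + 1` give the solution built on
`T_{m,n}`. The divisions are legitimate: top coefficients show `τ_n ≠ 0` for `n ≤ N + 1`, and `R_n`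
grows like `-z`.

The other solutions come from two symmetries: `z ↦ -z` negates the parameters, and adding a linear
function to `σ` exchanges the roots `0` and `-ν₁` of the quartic in `σ'`. Two solutions with equal
parameters differ because `z P'/P` is bounded at infinity while their difference contains `±(m+1)z`.
-/

namespace PainleveV

/-! ### The Toda chain of `σ`-functions in a differential field -/

section Chain

variable {K : Type*} [Field K] (D : Derivation ℤ K K)

/-- One step of the Toda chain preserves the factorised form of the `σ`-equation. -/
theorem factorised_step {a α β R r β' R' r' : K} (ha : D a = 0)
    (hR : D R = a - 2 * r - α * R) (hI : R * (β * R - D r) = r * (r - a))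
    (hβ : β' = β + D α) (hr : r' = r + D R) (hT : β' * R' = β' * R + D r') :
    R' * (β' * R' - D r') = r' * (r' - a) := by
  have h2 : D (2 : K) = 0 := D.map_natCast 2
  have hDr : D r' = D r + D (D R) := by rw [hr, map_add]
  have hDD : D (D R) = -2 * D r - D α * R - α * D R := by
    rw [hR]
    simp only [map_sub, Derivation.leibniz, smul_eq_mul, ha, h2, hR]
    ring
  -- The Toda relation `hT`, used twice, trades `R'` for `R`; what remains is `hI` and the
  -- derivative of the Riccati equation.
  have h1 : R' * (β' * R' - D r') = (β' * R + D r') * R := by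
    rw [← hT]
    linear_combination R' * hT
  rw [h1, hDr, hDD, hβ, hr, hR]
  linear_combination hI

/-- One step of the Toda chain preserves the Riccati equation. -/
theorem riccati_step {z a α R r α' β' R' r' : K} (ha : D a = 0)
    (hR : D R = a - 2 * r - α * R) (hr : r' = r + D R)
    (hI : R' * (β' * R' - D r') = r' * (r' - a))
    (hDr : D r' = β' * (R' - R)) (hDβ : z * D β' = β' * (R' - R - 2))
    (hα : z * (α' - α) = R' - R - 2) (hβ0 : β' ≠ 0) (hR0 : R ≠ 0) (hz0 : z ≠ 0) :
    D R' = a - 2 * r' - α' * R' := by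
  -- By Toda the factorised equation becomes a product formula; its derivative determines `D R'` up
  -- to the nonzero factor `β' * R * z`.
  have h2 : β' * R' * R = r' * (r' - a) := by
    rw [← hI, hDr]; ring
  have h3 := congrArg D h2
  simp only [map_sub, Derivation.leibniz, smul_eq_mul, ha, hDr] at h3
  have hR2 : D R = 2 * r' - a + α * R := by rw [hr]; linear_combination -hR
  rw [hR2] at h3
  have h4 : (β' * R * z) * (D R' - (a - 2 * r' - α' * R')) = 0 := by
    linear_combination z * h3 - R * R' * hDβ + β' * R * R' * hα
  have h5 : β' * R * z ≠ 0 := mul_ne_zero (mul_ne_zero hβ0 hR0) hz0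
  exact sub_eq_zero.mp ((mul_eq_zero.mp h4).resolve_left h5)

/-- The two factorised equations of the Toda chain of logarithmic derivatives `h n`. -/
theorem factorised_chain {z a b : K} (hz : D z = 1) (hz0 : z ≠ 0) (ha : D a = 0) (hb : D b = 0)
    (h : ℕ → K) (N : ℕ) (h0 : h 0 = 0)
    (h1 : z * D (h 1) + z * h 1 ^ 2 + (a + b + 1 - z) * h 1 + h 1 - a - 1 = 0)
    (hT : ∀ n < N, D (D (h (n + 1))) = D (h (n + 1)) * (h (n + 2) + h n - 2 * h (n + 1)))
    (hβ : ∀ n < N, D (h (n + 1)) ≠ 0)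
    (hR : ∀ n < N, z * (h (n + 1) - h n) - z + (2 * n + (a + b + 1)) ≠ 0) (n : ℕ) (hn : n ≤ N) :
    let R := z * (h (n + 1) - h n) - z + (2 * n + (a + b + 1))
    let r := h n + z * D (h n) - n
    R * (D (h n) * R - D r) = r * (r - a) ∧
      (z + R) * (D (h n) * (z + R) - D r) = (n + r) * (n + r + b) := by
  have hd2 : D (2 : K) = 0 := D.map_natCast 2
  -- The Riccati equation joins the induction because the factorised equations need it to propagate.
  -- Writing `D (n + r)` gives the second one the shape of the first.
  suffices H : ∀ n ≤ N,
      D (z * (h (n + 1) - h n) - z + (2 * n + (a + b + 1)))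
          = a - 2 * (h n + z * D (h n) - n)
            - (h (n + 1) - h n) * (z * (h (n + 1) - h n) - z + (2 * n + (a + b + 1))) ∧
        (let R := z * (h (n + 1) - h n) - z + (2 * n + (a + b + 1))
         let r := h n + z * D (h n) - n
         R * (D (h n) * R - D r) = r * (r - a) ∧
          (z + R) * (D (h n) * (z + R) - D (n + r)) = (n + r) * (n + r + b)) by
    have := (H n hn).2
    simpa only [map_add, Derivation.map_natCast, zero_add] using this
  clear hn n
  intro n
  induction n with
  | zero =>
    intro _
    simp only [h0, zero_add, Nat.cast_zero, map_zero, mul_zero, sub_zero, zero_mul, add_zero]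
    -- Since `h 0 = 0`, only the Riccati equation has content here.
    refine ⟨?_, ?_, ?_⟩
    · simp only [map_sub, map_add, Derivation.leibniz, smul_eq_mul, ha, hb, hz,
        Derivation.map_one_eq_zero]
      linear_combination h1
    · simp
    · simp
  | succ n ih =>
    intro hn
    obtain ⟨hS, hI1, hI2⟩ := ih (by omega)
    have hTn := hT n (by omega)
    have hRn := hR n (by omega)
    have hβn := hβ n (by omega)
    clear ih hT hR hβ h1 h0
    simp only [show n + 1 + 1 = n + 2 by rfl] at *
    push_cast
    generalize hRdef : z * (h (n + 1) - h n) - z + (2 * (n : K) + (a + b + 1)) = R at *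
    generalize hrdef : h n + z * D (h n) - (n : K) = r at *
    generalize hR'def : z * (h (n + 2) - h (n + 1)) - z + (2 * ((n : K) + 1) + (a + b + 1)) = R'
    generalize hr'def : h (n + 1) + z * D (h (n + 1)) - ((n : K) + 1) = r'
    have hDR : D R = h (n + 1) - h n + z * (D (h (n + 1)) - D (h n)) - 1 := by
      rw [← hRdef]
      simp only [map_sub, map_add, Derivation.leibniz, smul_eq_mul, ha, hb, hz, hd2,
        Derivation.map_one_eq_zero, Derivation.map_natCast]
      ring
    have hr : r' = r + D R := by
      rw [hDR, ← hr'def, ← hrdef]; ring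
    have hDr' : D r' = 2 * D (h (n + 1)) + z * D (D (h (n + 1))) := by
      rw [← hr'def]
      simp only [map_sub, map_add, Derivation.leibniz, smul_eq_mul, hz,
        Derivation.map_one_eq_zero, Derivation.map_natCast]
      ring
    have hRR : R' - R - 2 = z * (h (n + 2) + h n - 2 * h (n + 1)) := by
      rw [← hR'def, ← hRdef]; ring
    have hDr : D r' = D (h (n + 1)) * (R' - R) := by
      rw [hDr', hTn]; linear_combination (-D (h (n + 1))) * hRR
    have hI1' : R' * (D (h (n + 1)) * R' - D r') = r' * (r' - a) :=
      factorised_step D (α := h (n + 1) - h n) ha hS hI1 (by rw [map_sub]; ring) hr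
        (by rw [hDr]; ring)
    refine ⟨?_, hI1', ?_⟩
    · refine riccati_step D (β' := D (h (n + 1))) ha hS hr hI1' hDr ?_ ?_ hβn hRn hz0
      · rw [hTn, hRR]; ring
      · rw [hRR]; ring
    · have hb' : D (-b) = 0 := by rw [map_neg, hb, neg_zero]
      -- The second equation is the first with `a, α, R, r` replaced by `-b, α - 1, z + R, n + r`;
      -- the definition of `R` turns its Riccati equation into that of `R`.
      have := factorised_step D (a := -b) (α := h (n + 1) - h n - 1) (β := D (h n))
        (R := z + R) (r := n + r) (β' := D (h (n + 1))) (R' := z + R') (r' := n + 1 + r') hb'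
        (by rw [map_add, hz, hS]; linear_combination hRdef) (by rw [hI2]; ring)
        (by simp only [map_sub, Derivation.map_one_eq_zero]; ring)
        (by rw [map_add, hz, hr]; ring)
        (by simp only [map_add, Derivation.map_one_eq_zero, Derivation.map_natCast, hDr]; ring)
      rw [this]; ring

/-- The two factorised equations imply the `σ`-equation. -/
theorem sigma_equation_of_factorised {z a b h R n c : K} (hz : D z = 1) (hn : D n = 0)
    (hc : D c = 0)
    (hca : c = n * (n + a))
    (hI1 : R * (D h * R - D (h + z * D h - n)) = (h + z * D h - n) * ((h + z * D h - n) - a))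
    (hI2 : (z + R) * (D h * (z + R) - D (h + z * D h - n))
      = (n + (h + z * D h - n)) * (n + (h + z * D h - n) + b)) :
    (z * D (D (z * h + c))) ^ 2
      = (2 * D (z * h + c) ^ 2 + (-a - n + -n + b - z) * D (z * h + c) + (z * h + c)) ^ 2
        - 4 * D (z * h + c) * ((D (z * h + c) + (-a - n)) * (D (z * h + c) + -n)
          * (D (z * h + c) + b)) := by
  have h1 : D (z * h + c) = h + z * D h := by
    simp only [map_add, Derivation.leibniz, smul_eq_mul, hz, hc]; ring
  have h2 : D (h + z * D h - n) = D (h + z * D h) := by rw [map_sub, hn, sub_zero]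
  rw [h1]
  rw [h2] at hI1 hI2
  generalize D (h + z * D h) = r' at *
  generalize D h = β at *
  -- The difference of the two equations is linear in `R`; the first one times `4βz²` then completes
  -- the square of `2βRz - zr'`.
  have h3 : (2 * β * R * z - z * r') - ((h + z * β) * (h + z * β + b)
      - (h + z * β - n) * (h + z * β - n - a) - β * z ^ 2) = 0 := by
    linear_combination hI2 - hI1
  subst hca
  linear_combination ((2 * β * R * z - z * r') + ((h + z * β) * (h + z * β + b)
      - (h + z * β - n) * (h + z * β - n - a) - β * z ^ 2)) * h3 - 4 * β * z ^ 2 * hI1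

end Chain

/-! ### Hankel determinants of derivatives and the Toda equation -/

section Hankel

open Matrix

theorem derivation_prod {A ι : Type*} [CommRing A] [DecidableEq ι] (D : Derivation ℤ A A)
    (s : Finset ι) (f : ι → A) :
    D (∏ i ∈ s, f i) = ∑ i ∈ s, (∏ j ∈ s.erase i, f j) * D (f i) := by
  induction s using Finset.induction_on with
  | empty => simp
  | insert a s ha ih =>
    rw [Finset.prod_insert ha, Derivation.leibniz, ih, Finset.sum_insert ha,
      Finset.erase_insert ha, smul_eq_mul, smul_eq_mul, Finset.mul_sum, add_comm]
    congr 1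
    refine Finset.sum_congr rfl fun i hi => ?_
    have hia : a ≠ i := fun h => ha (h ▸ hi)
    rw [Finset.erase_insert_of_ne hia, Finset.prod_insert (by simp [ha]), mul_assoc]

/-- The derivative of a determinant, row by row. -/
theorem derivation_det {A ι : Type*} [CommRing A] [DecidableEq ι] [Fintype ι]
    (D : Derivation ℤ A A) (M : Matrix ι ι A) :
    D M.det = ∑ i, (M.updateRow i fun k => D (M i k)).det := by
  have h : ∀ i, (M.updateRow i fun k => D (M i k)).det
      = ∑ σ : Equiv.Perm ι, Equiv.Perm.sign σ •
        ((∏ j ∈ Finset.univ.erase i, M j (σ j)) * D (M i (σ i))) := by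
    intro i
    rw [← det_transpose, det_apply]
    refine Finset.sum_congr rfl fun σ _ => ?_
    congr 1
    rw [← Finset.prod_erase_mul _ _ (Finset.mem_univ i)]
    congr 1
    · refine Finset.prod_congr rfl fun j hj => ?_
      rw [transpose_apply, updateRow_ne (Finset.ne_of_mem_erase hj)]
    · rw [transpose_apply, updateRow_self]
  simp_rw [h]
  rw [Finset.sum_comm, ← det_transpose, det_apply, map_sum]
  refine Finset.sum_congr rfl fun σ _ => ?_
  rw [← Finset.smul_sum, ← derivation_prod]
  simp [Units.smul_def]

/-- The derivative of a Wronskian-like determinant only moves the last row. -/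
theorem derivation_det_rows {A : Type*} [CommRing A] (D : Derivation ℤ A A) {n : ℕ}
    (G : ℕ → Fin (n + 1) → A) (hG : ∀ i k, D (G i k) = G (i + 1) k) :
    D (of fun (i : Fin (n + 1)) k => G i k).det
      = (of fun (i : Fin (n + 1)) k => G (if i = Fin.last n then n + 1 else i) k).det := by
  rw [derivation_det, Fin.sum_univ_castSucc, Finset.sum_eq_zero, zero_add]
  · congr 1
    ext i k
    by_cases hi : i = Fin.last n
    · subst hi; simp [hG]
    · simp [hi]
  · intro i _
    -- Differentiating a row other than the last makes it equal to the next row.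
    refine det_zero_of_row_eq (i := i.castSucc) (j := i.succ) (by simp [Fin.ext_iff]) ?_
    ext k
    rw [updateRow_self, updateRow_ne (by simp [Fin.ext_iff])]
    simp [hG]

/-- The Desnanot–Jacobi identity for the last two rows and columns. -/
theorem det_mul_det_block {K ι : Type*} [Field K] [DecidableEq ι] [Fintype ι]
    (A : Matrix ι ι K) (B : Matrix ι (Fin 2) K) (C : Matrix (Fin 2) ι K)
    (E : Matrix (Fin 2) (Fin 2) K) (hA : A.det ≠ 0) (δ : Fin 2 → Fin 2 → K)
    (hδ : ∀ p q, δ p q = (fromBlocks A (B.submatrix id fun _ : Fin 1 => q)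
      (C.submatrix (fun _ : Fin 1 => p) id)
      (E.submatrix (fun _ : Fin 1 => p) fun _ : Fin 1 => q)).det) :
    (fromBlocks A B C E).det * A.det = δ 0 0 * δ 1 1 - δ 0 1 * δ 1 0 := by
  have : Invertible A := invertibleOfIsUnitDet A (isUnit_iff_ne_zero.mpr hA)
  -- Each bordered minor is `A.det` times an entry of the Schur complement of `A`.
  have h : ∀ p q, δ p q = A.det * (E - C * ⅟A * B) p q := by
    intro p q
    rw [hδ, det_fromBlocks₁₁, det_fin_one]
    rfl
  rw [det_fromBlocks₁₁, det_fin_two]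
  simp only [h]
  ring

/-- The Hankel determinant `det [D^{j+k} f]` of size `n`. -/
def hankel {A : Type*} [CommRing A] (D : Derivation ℤ A A) (f : A) (n : ℕ) : A :=
  (of fun j k : Fin n => D^[(j : ℕ) + (k : ℕ)] f).det

variable {K : Type*} [Field K] (D : Derivation ℤ K K) (f : K)

/-- The Toda equation for Hankel determinants of derivatives. -/
theorem hankel_toda (n : ℕ) (h0 : hankel D f n ≠ 0) :
    hankel D f (n + 2) * hankel D f n
      = hankel D f (n + 1) * D (D (hankel D f (n + 1))) - D (hankel D f (n + 1)) ^ 2 := by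
  let F : ℕ → ℕ → K := fun i j => D^[i + j] f
  have hF1 : ∀ i j, D (F i j) = F (i + 1) j := fun i j => by
    simp only [F, ← Function.iterate_succ_apply']
    congr 2; omega
  have hF2 : ∀ i j, D (F i j) = F i (j + 1) := fun i j => by
    simp only [F, ← Function.iterate_succ_apply']
    congr 2
  -- `ρ p` lists the indices `0, …, n-1, n+p`, so differentiating `δ` raises the last row or column
  -- index.
  let ρ : Fin 2 → Fin (n + 1) → ℕ := fun p i => if i = Fin.last n then n + p else i
  let δ : Fin 2 → Fin 2 → K := fun p q => (of fun i j => F (ρ p i) (ρ q j)).det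
  have hρ0 : ∀ i, ρ 0 i = i := fun i => by
    simp only [ρ]; split_ifs with h
    · simp [h]
    · rfl
  have hd0 : hankel D f (n + 1) = δ 0 0 := by
    simp only [δ, hρ0]; rfl
  have hd1 : D (δ 0 0) = δ 1 0 := by
    simp only [δ, hρ0]
    exact derivation_det_rows D (fun i k => F i k) fun i k => hF1 _ _
  have hcol : ∀ p, D (δ p 0) = δ p 1 := by
    intro p
    simp only [δ, hρ0]
    rw [← det_transpose, ← det_transpose (of fun i j => F (ρ p i) (ρ 1 j))]
    exact derivation_det_rows D (fun i k => F (ρ p k) i) fun i k => hF2 _ _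
  have key := det_mul_det_block (of fun i j : Fin n => F i j)
    (of fun (i : Fin n) (q : Fin 2) => F i (n + q)) (of fun (p : Fin 2) (j : Fin n) => F (n + p) j)
    (of fun p q : Fin 2 => F (n + p) (n + q)) h0 δ (by
      intro p q
      simp only [δ]
      rw [← det_submatrix_equiv_self (finSumFinEquiv (m := n) (n := 1))]
      congr 1
      ext (i | i) (j | j) <;>
        simp [ρ, Fin.ext_iff, i.isLt.ne, j.isLt.ne])
  have h2 : hankel D f (n + 2) = (fromBlocks (of fun i j : Fin n => F i j)
    (of fun (i : Fin n) (q : Fin 2) => F i (n + q)) (of fun (p : Fin 2) (j : Fin n) => F (n + p) j)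
    (of fun p q : Fin 2 => F (n + p) (n + q))).det := by
    rw [hankel, ← det_submatrix_equiv_self (finSumFinEquiv (m := n) (n := 2))]
    congr 1
    ext (i | i) (j | j) <;> simp [F]
  have h3 : (of fun i j : Fin n => F i j).det = hankel D f n := rfl
  rw [h3, ← h2] at key
  rw [key, hd0, hd1, hcol, ← hcol 0, hd1]
  ring

end Hankel

/-! ### From Hankel determinants to the `σ`-equation -/

section Sigma

variable {K : Type*} [Field K] (D : Derivation ℤ K K)

/-- If `f` solves the confluent hypergeometric equation with parameter `N`, the Hankel determinants
of its derivatives are `τ`-functions of the Painlevé V `σ`-equation. -/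
theorem sigma_equation_hankel {z b f : K} (hz : D z = 1) (hz0 : z ≠ 0) (hb : D b = 0) (N : ℕ)
    (hf : z * D (D f) + (b - N + 1 - z) * D f + N * f = 0)
    (hτ : ∀ n ≤ N + 1, hankel D f n ≠ 0)
    (hR : ∀ n < N, z * (D (hankel D f (n + 1)) * hankel D f n
        - hankel D f (n + 1) * D (hankel D f n))
      + (2 * n + (b - N) - z) * (hankel D f (n + 1) * hankel D f n) ≠ 0)
    (n : ℕ) (hn : n ≤ N) (σ : K)
    (hσ : σ = z * (D (hankel D f n) / hankel D f n) - (N - n + 1) * n) :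
    (z * D (D σ)) ^ 2
      = (2 * D σ ^ 2 + ((N - n + 1) + -n + b - z) * D σ + σ) ^ 2
        - 4 * D σ * ((D σ + (N - n + 1)) * (D σ + -n) * (D σ + b)) := by
  have hN : ∀ k : ℕ, D (k : K) = 0 := fun k => D.map_natCast k
  have ha : D (-((N : K) + 1)) = 0 := by
    rw [map_neg, map_add, hN, Derivation.map_one_eq_zero]; simp
  set τ : ℕ → K := hankel D f with hτdef
  have hτ0 : τ 0 = 1 := by simp [hτdef, hankel]
  have hτ1 : τ 1 = f := by simp [hτdef, hankel]
  set h : ℕ → K := fun n => D (τ n) / τ n with hh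
  have hlog : ∀ k ≤ N + 1, D (τ k) = τ k * h k := fun k hk => by
    simp only [hh]; field_simp [hτ k hk]
  have hβ : ∀ k < N, τ (k + 1) ^ 2 * D (h (k + 1)) = τ (k + 2) * τ k := by
    intro k hk
    have h1 := hτ (k + 1) (by omega)
    have h2 := hankel_toda D f k (hτ k (by omega))
    have h3 := hlog (k + 1) (by omega)
    rw [← hτdef, h3, Derivation.leibniz, smul_eq_mul, smul_eq_mul, h3] at h2
    rw [h2]; ring
  have hT : ∀ k < N, D (D (h (k + 1))) = D (h (k + 1)) * (h (k + 2) + h k - 2 * h (k + 1)) := by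
    intro k hk
    have h1 := congrArg D (hβ k hk)
    have h2 := hβ k hk
    rw [pow_two] at h1
    simp only [Derivation.leibniz, smul_eq_mul, hlog (k + 1) (by omega), hlog k (by omega),
      hlog (k + 2) (by omega)] at h1
    refine mul_left_cancel₀ (pow_ne_zero 2 (hτ (k + 1) (by omega))) ?_
    linear_combination h1 - (h (k + 2) + h k) * h2
  have hβ0 : ∀ k < N, D (h (k + 1)) ≠ 0 := by
    intro k hk h1
    have := hβ k hk
    rw [h1, mul_zero] at this
    -- The index `k + 2` reaches `N + 1`, hence the range in `hτ`.
    exact mul_ne_zero (hτ (k + 2) (by omega)) (hτ k (by omega)) this.symm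
  have hh0 : h 0 = 0 := by simp [hh, hτ0]
  have hf0 : f ≠ 0 := hτ1 ▸ hτ 1 (by omega)
  have hric : z * D (h 1) + z * h 1 ^ 2 + (-((N : K) + 1) + b + 1 - z) * h 1 + h 1
      - -((N : K) + 1) - 1 = 0 := by
    have h1 := hlog 1 (by omega)
    rw [hτ1] at h1
    rw [h1, Derivation.leibniz, h1, smul_eq_mul, smul_eq_mul] at hf
    refine mul_left_cancel₀ hf0 ?_
    linear_combination hf
  obtain ⟨hI1, hI2⟩ := factorised_chain D hz hz0 ha hb h N hh0 hric hT hβ0 (by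
    intro k hk h1
    apply hR k hk
    rw [hlog (k + 1) (by omega), hlog k (by omega)]
    linear_combination (τ (k + 1) * τ k) * h1) n hn
  have hc : D (-((N : K) - n + 1) * n) = 0 := by
    simp [Derivation.leibniz, hN]
  have := sigma_equation_of_factorised D hz (hN n) hc (by ring) hI1 hI2
  rw [show z * h n + -((N : K) - n + 1) * n = σ by rw [hσ]; ring] at this
  rw [this]; ring

end Sigma

/-! ### Differentiation of rational functions -/

/-- `ratDeriv` is defined by the reduced fraction; this independence of the representative allows
any fraction to be used. -/
theorem quotient_rule_congr {p q r s : ℂ[X]} (hq : q ≠ 0) (hs : s ≠ 0)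
    (h : algebraMap ℂ[X] (RatFunc ℂ) r / algebraMap ℂ[X] (RatFunc ℂ) s
      = algebraMap ℂ[X] (RatFunc ℂ) p / algebraMap ℂ[X] (RatFunc ℂ) q) :
    (algebraMap ℂ[X] (RatFunc ℂ) (derivative r) * algebraMap ℂ[X] (RatFunc ℂ) s
        - algebraMap ℂ[X] (RatFunc ℂ) r * algebraMap ℂ[X] (RatFunc ℂ) (derivative s))
        / algebraMap ℂ[X] (RatFunc ℂ) s ^ 2
      = (algebraMap ℂ[X] (RatFunc ℂ) (derivative p) * algebraMap ℂ[X] (RatFunc ℂ) q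
        - algebraMap ℂ[X] (RatFunc ℂ) p * algebraMap ℂ[X] (RatFunc ℂ) (derivative q))
        / algebraMap ℂ[X] (RatFunc ℂ) q ^ 2 := by
  have hq' := RatFunc.algebraMap_ne_zero hq
  have hs' := RatFunc.algebraMap_ne_zero hs
  rw [div_eq_div_iff hs' hq'] at h
  have h1 : r * q = p * s := RatFunc.algebraMap_injective ℂ (by rw [map_mul, map_mul, h])
  have h2 := congrArg derivative h1
  rw [derivative_mul, derivative_mul] at h2
  have h3 : (derivative r * s - r * derivative s) * q ^ 2
      = (derivative p * q - p * derivative q) * s ^ 2 := by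
    linear_combination q * s * h2 - (derivative s * q + s * derivative q) * h1
  rw [div_eq_div_iff (pow_ne_zero 2 hs') (pow_ne_zero 2 hq')]
  simpa only [map_mul, map_pow, map_sub] using congrArg (algebraMap ℂ[X] (RatFunc ℂ)) h3

theorem ratDeriv_div (p q : ℂ[X]) (hq : q ≠ 0) :
    ratDeriv (algebraMap ℂ[X] (RatFunc ℂ) p / algebraMap ℂ[X] (RatFunc ℂ) q)
      = (algebraMap ℂ[X] (RatFunc ℂ) (derivative p) * algebraMap ℂ[X] (RatFunc ℂ) q
        - algebraMap ℂ[X] (RatFunc ℂ) p * algebraMap ℂ[X] (RatFunc ℂ) (derivative q))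
        / algebraMap ℂ[X] (RatFunc ℂ) q ^ 2 :=
  quotient_rule_congr hq (RatFunc.denom_ne_zero _) (RatFunc.num_div_denom _)

theorem ratDeriv_algebraMap (p : ℂ[X]) :
    ratDeriv (algebraMap ℂ[X] (RatFunc ℂ) p) = algebraMap ℂ[X] (RatFunc ℂ) (derivative p) := by
  simpa using ratDeriv_div p 1 one_ne_zero

theorem ratDeriv_add (x y : RatFunc ℂ) : ratDeriv (x + y) = ratDeriv x + ratDeriv y := by
  induction x using RatFunc.induction_on with | _ p q hq => ?_
  induction y using RatFunc.induction_on with | _ r s hs => ?_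
  have hq' := RatFunc.algebraMap_ne_zero hq
  have hs' := RatFunc.algebraMap_ne_zero hs
  rw [div_add_div _ _ hq' hs', ← map_mul, ← map_mul, ← map_mul, ← map_add,
    ratDeriv_div _ _ (mul_ne_zero hq hs), ratDeriv_div _ _ hq, ratDeriv_div _ _ hs]
  simp only [derivative_mul, map_add, map_mul]
  field_simp
  ring

theorem ratDeriv_mul (x y : RatFunc ℂ) :
    ratDeriv (x * y) = x * ratDeriv y + y * ratDeriv x := by
  induction x using RatFunc.induction_on with | _ p q hq => ?_
  induction y using RatFunc.induction_on with | _ r s hs => ?_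
  have hq' := RatFunc.algebraMap_ne_zero hq
  have hs' := RatFunc.algebraMap_ne_zero hs
  rw [div_mul_div_comm, ← map_mul, ← map_mul,
    ratDeriv_div _ _ (mul_ne_zero hq hs), ratDeriv_div _ _ hq, ratDeriv_div _ _ hs]
  simp only [derivative_mul, map_add, map_mul]
  field_simp
  ring

/-- An additive map satisfying the Leibniz rule, as a derivation over `ℤ`. -/
def derivationOfLeibniz {A : Type*} [CommRing A] (d : A →+ A)
    (h : ∀ x y, d (x * y) = x * d y + y * d x) : Derivation ℤ A A :=
  Derivation.mk' d.toIntLinearMap h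

/-- `ratDeriv` as a derivation of the field of rational functions. -/
noncomputable def ratDerivation :=
  derivationOfLeibniz (AddMonoidHom.mk' ratDeriv ratDeriv_add) ratDeriv_mul

theorem ratDerivation_apply (x : RatFunc ℂ) : ratDerivation x = ratDeriv x := rfl

theorem ratDerivation_algebraMap (p : ℂ[X]) :
    ratDerivation (algebraMap ℂ[X] (RatFunc ℂ) p) = algebraMap ℂ[X] (RatFunc ℂ) (derivative p) :=
  ratDeriv_algebraMap p

theorem ratDerivation_X : ratDerivation RatFunc.X = 1 := by
  simpa using ratDerivation_algebraMap X

theorem ratDerivation_C (c : ℂ) : ratDerivation (RatFunc.C c) = 0 := by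
  simpa using ratDerivation_algebraMap (C c)

theorem zLogDeriv_eq (P : ℂ[X]) :
    zLogDeriv P = RatFunc.X * (algebraMap ℂ[X] (RatFunc ℂ) (derivative P)
      / algebraMap ℂ[X] (RatFunc ℂ) P) := by
  rw [zLogDeriv, ratDeriv_algebraMap]

/-- All terms have degree at most `deg PQ` except `c X P Q`, which nothing can cancel. This yields
both `R_n ≠ 0` and the distinctness of the solutions. -/
theorem X_mul_wronskian_add_ne_zero {P Q : ℂ[X]} (hP : P ≠ 0) (hQ : Q ≠ 0) {c : ℂ} (hc : c ≠ 0)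
    (d : ℂ) :
    X * (derivative P * Q - P * derivative Q) + (C d + C c * X) * (P * Q) ≠ 0 := by
  intro h
  have hPQ : P * Q ≠ 0 := mul_ne_zero hP hQ
  have hX : ∀ R : ℂ[X], (X * derivative R).natDegree ≤ R.natDegree := fun R => by
    by_cases hR : R.natDegree = 0
    · rw [natDegree_eq_zero.mp hR |>.choose_spec.symm]; simp
    · calc (X * derivative R).natDegree ≤ X.natDegree + (derivative R).natDegree :=
            natDegree_mul_le
        _ ≤ 1 + (R.natDegree - 1) := add_le_add natDegree_X_le (natDegree_derivative_le R)
        _ = R.natDegree := by omega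
  have h1 : (X * derivative P * Q - P * (X * derivative Q) + C d * (P * Q)).natDegree
      ≤ (P * Q).natDegree := by
    rw [natDegree_mul hP hQ]
    refine natDegree_add_le_of_degree_le ((natDegree_sub_le_of_le ?_ ?_).trans (max_self _).le) ?_
    · exact natDegree_mul_le.trans (add_le_add_left (hX P) _)
    · exact natDegree_mul_le.trans (add_le_add_right (hX Q) _)
    · exact (natDegree_C_mul_le _ _).trans natDegree_mul_le
  have h2 : C c * X * (P * Q)
      = -(X * derivative P * Q - P * (X * derivative Q) + C d * (P * Q)) := by
    linear_combination h
  have h3 : (C c * X * (P * Q)).natDegree = 1 + (P * Q).natDegree := by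
    rw [natDegree_mul (mul_ne_zero (by simpa using hc) X_ne_zero) hPQ, natDegree_C_mul_X _ hc]
  rw [h2, natDegree_neg] at h3
  omega

theorem zLogDeriv_sub_ne {P Q : ℂ[X]} (hP : P ≠ 0) (hQ : Q ≠ 0) {c : ℂ} (hc : c ≠ 0) :
    zLogDeriv P - zLogDeriv Q + RatFunc.C c * RatFunc.X ≠ 0 := by
  intro h
  apply X_mul_wronskian_add_ne_zero hP hQ hc 0
  apply RatFunc.algebraMap_injective ℂ
  have hP' := RatFunc.algebraMap_ne_zero hP
  have hQ' := RatFunc.algebraMap_ne_zero hQ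
  rw [zLogDeriv_eq, zLogDeriv_eq] at h
  simp only [map_add, map_sub, map_mul, RatFunc.algebraMap_X, RatFunc.algebraMap_C, map_zero,
    zero_add]
  field_simp at h
  linear_combination h

/-! ### Nonvanishing of Hankel determinants of a polynomial -/

/-- The falling factorial of order `j + k` of `N` is that of order `j` of `N` times that of order
`k` of `N - j`. The first factor leaves each row, nonzero as `j ≤ N`; a Vandermonde determinant at
the nodes `N - j` remains. -/
theorem det_descFactorial_ne_zero (n N : ℕ) (hn : n ≤ N + 1) :
    (Matrix.of fun j k : Fin n => (N.descFactorial (j + k) : ℂ)).det ≠ 0 := by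
  have h1 : (Matrix.of fun j k : Fin n => (N.descFactorial (j + k) : ℂ))
      = Matrix.of fun j k : Fin n => (N.descFactorial j : ℂ)
        * (Matrix.of fun j k : Fin n => (descPochhammer ℂ k).eval ((N : ℂ) - j)) j k := by
    ext j k
    have hj : (j : ℕ) ≤ N := by omega
    rw [Matrix.of_apply, Matrix.of_apply, Matrix.of_apply, ← Nat.cast_sub hj,
      descPochhammer_eval_eq_descFactorial]
    have := Nat.descFactorial_mul_descFactorial (n := N) (Nat.le_add_right (j : ℕ) k)
    rw [Nat.add_sub_cancel_left] at this
    rw [← this]; push_cast; ring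
  rw [h1, Matrix.det_mul_column]
  refine mul_ne_zero (Finset.prod_ne_zero_iff.mpr fun j _ => ?_) ?_
  · have hj : (j : ℕ) ≤ N := by omega
    exact_mod_cast (Nat.descFactorial_pos.mpr hj).ne'
  · have h2 := Matrix.det_eval_matrixOfPolynomials_eq_det_vandermonde
      (fun j : Fin n => (N : ℂ) - j) (fun k => descPochhammer ℂ k)
      (fun k => descPochhammer_natDegree ℂ k) (fun k => monic_descPochhammer ℂ k)
    rw [← h2, Matrix.det_vandermonde_ne_zero_iff]
    intro i j hij
    simpa [Fin.ext_iff] using hij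

/-- After scaling row `j` by `X^j` and column `k` by `X^k`, all entries have degree at most `N`, so
the coefficient of `X^(nN)` is the determinant of the entries' coefficients at `N`. -/
theorem det_iterate_derivative_ne_zero (f : ℂ[X]) (hf : f ≠ 0) (n : ℕ) (hn : n ≤ f.natDegree + 1) :
    (Matrix.of fun j k : Fin n => derivative^[(j : ℕ) + k] f).det ≠ 0 := by
  set N := f.natDegree with hN
  intro h
  have h1 : (Matrix.of fun j k : Fin n => X ^ (j : ℕ) *
      (Matrix.of fun j k : Fin n => X ^ (k : ℕ) *
        (Matrix.of fun j k : Fin n => derivative^[(j : ℕ) + k] f) j k) j k).det = 0 := by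
    rw [Matrix.det_mul_column, Matrix.det_mul_row, h, mul_zero, mul_zero]
  have h2 := congrArg (fun p => coeff p (n * N)) h1
  simp only [Matrix.det_apply, finsetSum_coeff, coeff_smul, coeff_zero, Matrix.of_apply] at h2
  have hdeg : ∀ i j : ℕ, (X ^ i * (X ^ j * derivative^[i + j] f)).natDegree ≤ N := fun i j => by
    rw [← mul_assoc, ← pow_add]
    by_cases hij : N < i + j
    · rw [iterate_derivative_eq_zero hij]; simp
    · refine natDegree_mul_le.trans ?_
      have := natDegree_iterate_derivative f (i + j)
      rw [natDegree_X_pow]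
      omega
  have hcoeff : ∀ i j : ℕ, (X ^ i * (X ^ j * derivative^[i + j] f)).coeff N
      = f.leadingCoeff * N.descFactorial (i + j) := fun i j => by
    rw [← mul_assoc, ← pow_add]
    by_cases hij : N < i + j
    · rw [iterate_derivative_eq_zero hij, Nat.descFactorial_eq_zero_iff_lt.mpr hij]; simp
    · obtain ⟨d, hd⟩ := Nat.exists_eq_add_of_le (not_lt.mp hij)
      have := coeff_X_pow_mul (derivative^[i + j] f) (i + j) d
      have hd' : d + (i + j) = N := by omega
      rw [hd', coeff_iterate_derivative, hd', nsmul_eq_mul] at this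
      rw [this, mul_comm, leadingCoeff]
  have h3 : ∀ σ : Equiv.Perm (Fin n), (∏ i, X ^ ((σ i : Fin n) : ℕ) * (X ^ (i : ℕ) *
      derivative^[((σ i : Fin n) : ℕ) + i] f)).coeff (n * N)
      = ∏ i, f.leadingCoeff * (N.descFactorial (((σ i : Fin n) : ℕ) + i) : ℂ) := fun σ => by
    have := coeff_prod_of_natDegree_le Finset.univ (fun i : Fin n => X ^ ((σ i : Fin n) : ℕ) *
      (X ^ (i : ℕ) * derivative^[((σ i : Fin n) : ℕ) + i] f)) N fun i _ => hdeg _ _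
    rw [Finset.card_univ, Fintype.card_fin] at this
    rw [this]
    exact Finset.prod_congr rfl fun i _ => hcoeff _ _
  simp_rw [h3] at h2
  simp only [Finset.prod_mul_distrib, Finset.prod_const, Finset.card_univ,
    Fintype.card_fin] at h2
  apply det_descFactorial_ne_zero n N hn
  rw [Matrix.det_apply]
  have hl : f.leadingCoeff ^ n ≠ 0 := pow_ne_zero _ (leadingCoeff_ne_zero.mpr hf)
  refine mul_left_cancel₀ hl ?_
  rw [mul_zero, Finset.mul_sum, ← h2]
  refine Finset.sum_congr rfl fun σ _ => ?_
  rw [mul_smul_comm]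
  rfl

/-! ### Laguerre polynomials -/

theorem coeff_laguerre (n : ℕ) (α : ℂ) (i : ℕ) :
    (laguerre n α).coeff i = if i ≤ n then
      (-1) ^ i * ((descPochhammer ℂ (n - i)).eval ((n : ℂ) + α) / ((n - i).factorial : ℂ))
        / (i.factorial : ℂ) else 0 := by
  simp only [laguerre, finsetSum_coeff, coeff_C_mul, coeff_X_pow, mul_ite, mul_one, mul_zero,
    Finset.sum_ite_eq, Finset.mem_range, Nat.lt_succ_iff]

theorem natDegree_laguerre (n : ℕ) (α : ℂ) : (laguerre n α).natDegree = n := by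
  refine natDegree_eq_of_le_of_coeff_ne_zero ?_ ?_
  · refine natDegree_le_iff_coeff_eq_zero.mpr fun i hi => ?_
    rw [coeff_laguerre, if_neg (not_le.mpr hi)]
  · simp [coeff_laguerre, Nat.factorial_ne_zero]

theorem laguerre_ne_zero (n : ℕ) (α : ℂ) : laguerre n α ≠ 0 := by
  intro h
  have : (laguerre n α).coeff n ≠ 0 := by simp [coeff_laguerre, Nat.factorial_ne_zero]
  simp [h] at this

theorem laguerre_ode (n : ℕ) (α : ℂ) :
    X * derivative (derivative (laguerre n α)) + (C α + 1 - X) * derivative (laguerre n α)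
      + (n : ℂ[X]) * laguerre n α = 0 := by
  have hrec : ∀ i : ℕ, ((i : ℂ) + 1) * (i + 1 + α) * (laguerre n α).coeff (i + 1)
      + (n - i) * (laguerre n α).coeff i = 0 := by
    intro i
    rw [coeff_laguerre, coeff_laguerre]
    rcases lt_trichotomy i n with h | h | h
    · obtain ⟨d, rfl⟩ := Nat.exists_eq_add_of_lt h
      rw [if_pos (by omega), if_pos (by omega), show i + d + 1 - (i + 1) = d by omega,
        show i + d + 1 - i = d + 1 by omega, descPochhammer_succ_eval, Nat.factorial_succ,
        Nat.factorial_succ]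
      have h1 : (i.factorial : ℂ) ≠ 0 := by exact_mod_cast i.factorial_ne_zero
      have h2 : (d.factorial : ℂ) ≠ 0 := by exact_mod_cast d.factorial_ne_zero
      have h3 : (i : ℂ) + 1 ≠ 0 := by exact_mod_cast i.succ_ne_zero
      have h4 : (d : ℂ) + 1 ≠ 0 := by exact_mod_cast d.succ_ne_zero
      push_cast
      field_simp
      ring
    · subst h; simp
    · rw [if_neg (by omega), if_neg (by omega)]; simp
  ext i
  have h := hrec i
  rw [add_sub_assoc, sub_eq_add_neg, ← add_assoc]
  simp only [add_mul, neg_mul, one_mul, coeff_add, coeff_neg, coeff_zero, coeff_C_mul,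
    coeff_natCast_mul]
  cases i with
  | zero =>
    simp only [coeff_X_mul_zero, coeff_derivative, Nat.cast_zero] at h ⊢
    linear_combination h
  | succ i =>
    simp only [coeff_X_mul, coeff_derivative] at h ⊢
    push_cast at h ⊢
    linear_combination h

theorem genLaguerre_ne_zero (m n : ℕ) (μ : ℂ) : genLaguerre m n μ ≠ 0 :=
  det_iterate_derivative_ne_zero _ (laguerre_ne_zero _ _) n
    (by rw [natDegree_laguerre]; omega)

theorem hankel_algebraMap (f : ℂ[X]) (n : ℕ) :
    hankel ratDerivation (algebraMap ℂ[X] (RatFunc ℂ) f) n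
      = algebraMap ℂ[X] (RatFunc ℂ)
        (Matrix.of fun j k : Fin n => derivative^[(j : ℕ) + (k : ℕ)] f).det := by
  have h : ∀ k : ℕ, ratDerivation^[k] (algebraMap ℂ[X] (RatFunc ℂ) f)
      = algebraMap ℂ[X] (RatFunc ℂ) (derivative^[k] f) := fun k => by
    induction k with
    | zero => rfl
    | succ k ih =>
      rw [Function.iterate_succ_apply', Function.iterate_succ_apply', ih, ratDerivation_algebraMap]
  rw [hankel, RingHom.map_det]
  congr 1
  ext j k
  simp [h]

/-- The generalised Laguerre polynomials give solutions of the Painlevé V `σ`-equation. -/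
theorem isRationalSolutionSV_genLaguerre (m n : ℕ) (μ : ℂ) :
    IsRationalSolutionSV ((m : ℂ) + 1) (-(n : ℂ)) ((m : ℂ) + n + μ + 1)
      (zLogDeriv (genLaguerre m n μ) - RatFunc.C (((m : ℂ) + 1) * n)) := by
  set f := laguerre (m + n) (μ + 1) with hf
  have hτ : ∀ k ≤ m + n + 1,
      (Matrix.of fun i j : Fin k => derivative^[(i : ℕ) + (j : ℕ)] f).det ≠ 0 := fun k hk =>
    det_iterate_derivative_ne_zero _ (laguerre_ne_zero _ _) k (by rwa [natDegree_laguerre])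
  -- Here `b - N = μ + 1` is the Laguerre parameter.
  have key := sigma_equation_hankel ratDerivation (z := RatFunc.X)
    (b := RatFunc.C ((m : ℂ) + n + μ + 1)) (f := algebraMap ℂ[X] (RatFunc ℂ) f)
    ratDerivation_X RatFunc.X_ne_zero (ratDerivation_C _) (m + n)
    (by
      have h := congrArg (algebraMap ℂ[X] (RatFunc ℂ)) (laguerre_ode (m + n) (μ + 1))
      simp only [map_add, map_sub, map_mul, map_one, map_zero, RatFunc.algebraMap_X,
        RatFunc.algebraMap_C, map_natCast, ← hf] at h
      simp only [ratDerivation_algebraMap, map_add, map_one, map_natCast]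
      push_cast at h ⊢
      linear_combination h)
    (fun k hk => by
      rw [hankel_algebraMap]
      exact RatFunc.algebraMap_ne_zero (hτ k hk))
    (fun k hk => by
      have h := RatFunc.algebraMap_ne_zero (X_mul_wronskian_add_ne_zero (hτ (k + 1) (by omega))
        (hτ k (by omega)) (neg_ne_zero.mpr one_ne_zero) (2 * (k : ℂ) + (μ + 1)))
      simp only [hankel_algebraMap, ratDerivation_algebraMap]
      convert h using 1
      simp only [map_add, map_sub, map_mul, map_one, RatFunc.algebraMap_X,
        RatFunc.algebraMap_C, map_natCast, map_neg, map_ofNat]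
      push_cast
      ring)
    n (by omega) (zLogDeriv (genLaguerre m n μ) - RatFunc.C (((m : ℂ) + 1) * n))
    (by
      rw [hankel_algebraMap, ratDerivation_algebraMap, zLogDeriv_eq, genLaguerre, ← hf]
      simp only [map_add, map_mul, map_one, map_natCast]
      push_cast
      ring)
  rw [IsRationalSolutionSV]
  simp only [ratDerivation_apply] at key
  rw [key]
  simp only [map_add, map_mul, map_one, map_natCast, map_neg]
  push_cast
  ring

/-! ### Symmetries of the `σ`-equation -/

theorem ratDeriv_add_linear (σ : RatFunc ℂ) (c d : ℂ) :
    ratDeriv (σ + RatFunc.C c * RatFunc.X + RatFunc.C d) = ratDeriv σ + RatFunc.C c := by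
  simp only [← ratDerivation_apply, map_add, Derivation.leibniz, ratDerivation_C, ratDerivation_X,
    smul_eq_mul]
  ring

/-- The `σ`-equation is symmetric under exchanging the root `0` with the root `ν₁`. -/
theorem IsRationalSolutionSV.shift {ν₁ ν₂ ν₃ : ℂ} {σ : RatFunc ℂ}
    (h : IsRationalSolutionSV ν₁ ν₂ ν₃ σ) :
    IsRationalSolutionSV (-ν₁) (ν₃ - ν₁) (ν₂ - ν₁)
      (σ + RatFunc.C ν₁ * RatFunc.X + RatFunc.C (ν₁ * (ν₁ - ν₂ - ν₃))) := by
  have h2 : ratDeriv (ratDeriv σ + RatFunc.C ν₁) = ratDeriv (ratDeriv σ) := by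
    rw [← ratDerivation_apply, map_add, ratDerivation_C, add_zero, ratDerivation_apply]
  unfold IsRationalSolutionSV at h ⊢
  -- The constant added to `σ` is the one that leaves the squared bracket unchanged.
  rw [ratDeriv_add_linear, h2, h]
  simp only [map_add, map_sub, map_mul, map_neg]
  ring

/-- The automorphism `z ↦ -z` of the field of rational functions. -/
noncomputable def ratReflect : RatFunc ℂ →+* RatFunc ℂ :=
  RatFunc.mapRingHom (compRingHom (-X : ℂ[X])) (by
    intro p hp
    rw [Submonoid.mem_comap, mem_nonZeroDivisors_iff_ne_zero]
    rw [mem_nonZeroDivisors_iff_ne_zero] at hp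
    intro h
    apply hp
    have := congrArg (fun q => q.comp (-X)) h
    simpa [comp_assoc] using this)

theorem ratReflect_div (p q : ℂ[X]) :
    ratReflect (algebraMap ℂ[X] (RatFunc ℂ) p / algebraMap ℂ[X] (RatFunc ℂ) q)
      = algebraMap ℂ[X] (RatFunc ℂ) (p.comp (-X)) / algebraMap ℂ[X] (RatFunc ℂ) (q.comp (-X)) := by
  rw [ratReflect, RatFunc.coe_mapRingHom_eq_coe_map, RatFunc.map_apply_div]
  rfl

theorem ratReflect_algebraMap (p : ℂ[X]) :
    ratReflect (algebraMap ℂ[X] (RatFunc ℂ) p) = algebraMap ℂ[X] (RatFunc ℂ) (p.comp (-X)) := by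
  simpa using ratReflect_div p 1

theorem ratReflect_X : ratReflect RatFunc.X = -RatFunc.X := by
  simpa using ratReflect_algebraMap X

theorem ratReflect_C (c : ℂ) : ratReflect (RatFunc.C c) = RatFunc.C c := by
  simpa using ratReflect_algebraMap (C c)

theorem derivative_comp_neg_X (p : ℂ[X]) :
    derivative (p.comp (-X)) = -(derivative p).comp (-X) := by
  simp [derivative_comp]

theorem comp_neg_X_ne_zero {p : ℂ[X]} (hp : p ≠ 0) : p.comp (-X) ≠ 0 := by
  intro h
  apply hp
  have := congrArg (fun q => q.comp (-X)) h
  simpa [comp_assoc] using this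

theorem ratDeriv_ratReflect (x : RatFunc ℂ) :
    ratDeriv (ratReflect x) = -ratReflect (ratDeriv x) := by
  induction x using RatFunc.induction_on with | _ p q hq => ?_
  rw [ratReflect_div, ratDeriv_div _ _ (comp_neg_X_ne_zero hq), ratDeriv_div _ _ hq]
  simp only [derivative_comp_neg_X, map_div₀, map_sub, map_mul, map_pow, ratReflect_algebraMap,
    map_neg]
  ring

theorem zLogDeriv_comp_neg_X (P : ℂ[X]) :
    zLogDeriv (P.comp (-X)) = ratReflect (zLogDeriv P) := by
  rw [zLogDeriv_eq, zLogDeriv_eq, map_mul, ratReflect_div, derivative_comp_neg_X, ratReflect_X,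
    map_neg]
  ring

/-- The substitution `z ↦ -z` negates the parameters of the `σ`-equation. -/
theorem IsRationalSolutionSV.reflect {ν₁ ν₂ ν₃ : ℂ} {σ : RatFunc ℂ}
    (h : IsRationalSolutionSV ν₁ ν₂ ν₃ σ) :
    IsRationalSolutionSV (-ν₁) (-ν₂) (-ν₃) (ratReflect σ) := by
  unfold IsRationalSolutionSV at h ⊢
  have h1 := congrArg ratReflect h
  have h2 : ratDeriv (-ratReflect (ratDeriv σ)) = ratReflect (ratDeriv (ratDeriv σ)) := by
    rw [← ratDerivation_apply, map_neg, ratDerivation_apply, ratDeriv_ratReflect, neg_neg]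
  simp only [map_pow, map_mul, map_sub, map_add, ratReflect_X, ratReflect_C, map_ofNat] at h1
  rw [ratDeriv_ratReflect, h2]
  simp only [map_neg, map_add]
  linear_combination h1

/-- The chain rule puts a sign `(-1)^(j+k)` on entry `(j, k)`; the row and column signs cancel in
the determinant. -/
theorem genLaguerreHat_eq (m n : ℕ) (μ : ℂ) :
    genLaguerreHat m n μ = (genLaguerre m n μ).comp (-X) := by
  have h : ∀ (f : ℂ[X]) (k : ℕ),
      derivative^[k] (f.comp (-X)) = (-1) ^ k * (derivative^[k] f).comp (-X) := fun f k => by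
    induction k with
    | zero => simp
    | succ k ih =>
      rw [Function.iterate_succ_apply', Function.iterate_succ_apply', ih]
      have h1 : ((-1 : ℂ[X]) ^ k) = C ((-1) ^ k) := by simp
      rw [h1, derivative_C_mul, derivative_comp_neg_X, ← h1]
      ring
  set f := laguerre (m + n) (μ + 1)
  have h1 : (Matrix.of fun j k : Fin n => derivative^[(j : ℕ) + (k : ℕ)] (f.comp (-X)))
      = Matrix.of fun j k : Fin n => (-1) ^ (j : ℕ) * (Matrix.of fun j k : Fin n =>
        (-1) ^ (k : ℕ) * (Matrix.of fun j k : Fin n =>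
          (derivative^[(j : ℕ) + (k : ℕ)] f).comp (-X)) j k) j k := by
    ext1 j k
    simp only [Matrix.of_apply, h, pow_add, mul_assoc]
  have h2 : (Matrix.of fun j k : Fin n => (derivative^[(j : ℕ) + (k : ℕ)] f).comp (-X)).det
      = (genLaguerre m n μ).comp (-X) := by
    have := RingHom.map_det (compRingHom (-X : ℂ[X]))
      (Matrix.of fun j k : Fin n => derivative^[(j : ℕ) + (k : ℕ)] f)
    exact this.symm
  rw [genLaguerreHat, h1, Matrix.det_mul_column, Matrix.det_mul_row, h2, ← mul_assoc,
    ← Finset.prod_mul_distrib]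
  simp [← mul_pow]

theorem genLaguerreHat_ne_zero (m n : ℕ) (μ : ℂ) : genLaguerreHat m n μ ≠ 0 := by
  rw [genLaguerreHat_eq]
  exact comp_neg_X_ne_zero (genLaguerre_ne_zero m n μ)

theorem isRationalSolutionSV_genLaguerreHat (m n : ℕ) (μ : ℂ) :
    IsRationalSolutionSV (-((m : ℂ) + 1)) (n : ℂ) (-((m : ℂ) + n + μ + 1))
      (zLogDeriv (genLaguerreHat m n μ) - RatFunc.C (((m : ℂ) + 1) * n)) := by
  have h := (isRationalSolutionSV_genLaguerre m n μ).reflect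
  rwa [map_sub, ratReflect_C, ← zLogDeriv_comp_neg_X, ← genLaguerreHat_eq, neg_neg] at h

end PainleveV

/-! ### The two pairs of solutions -/

theorem mainTheorem5 (m n : ℕ) (hn : 1 ≤ n) (k : ℤ) (hk : -(n : ℤ) ≤ k) :
    -- parameters `(m+1, -n, m+n+k+1)`
    (PainleveV.genLaguerre m n (k : ℂ) ≠ 0 ∧
      PainleveV.genLaguerreHat m ((n : ℤ) + k).toNat (-(k : ℂ)) ≠ 0 ∧
      PainleveV.IsRationalSolutionSV ((m : ℂ) + 1) (-(n : ℂ)) ((m : ℂ) + n + k + 1)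
        (PainleveV.zLogDeriv (PainleveV.genLaguerre m n (k : ℂ))
          - RatFunc.C (((m : ℂ) + 1) * n)) ∧
      PainleveV.IsRationalSolutionSV ((m : ℂ) + 1) (-(n : ℂ)) ((m : ℂ) + n + k + 1)
        (PainleveV.zLogDeriv (PainleveV.genLaguerreHat m ((n : ℤ) + k).toNat (-(k : ℂ)))
          - RatFunc.C ((m : ℂ) + 1) * RatFunc.X - RatFunc.C (((m : ℂ) + 1) * n)) ∧
      PainleveV.zLogDeriv (PainleveV.genLaguerre m n (k : ℂ))
          - RatFunc.C (((m : ℂ) + 1) * n)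
        ≠ PainleveV.zLogDeriv (PainleveV.genLaguerreHat m ((n : ℤ) + k).toNat (-(k : ℂ)))
          - RatFunc.C ((m : ℂ) + 1) * RatFunc.X - RatFunc.C (((m : ℂ) + 1) * n)) ∧
    -- parameters `(-m-1, n, -m-n-k-1)`
    (PainleveV.genLaguerreHat m n (k : ℂ) ≠ 0 ∧
      PainleveV.genLaguerre m ((n : ℤ) + k).toNat (-(k : ℂ)) ≠ 0 ∧
      PainleveV.IsRationalSolutionSV (-(m : ℂ) - 1) (n : ℂ) (-(m : ℂ) - n - k - 1)
        (PainleveV.zLogDeriv (PainleveV.genLaguerreHat m n (k : ℂ))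
          - RatFunc.C (((m : ℂ) + 1) * n)) ∧
      PainleveV.IsRationalSolutionSV (-(m : ℂ) - 1) (n : ℂ) (-(m : ℂ) - n - k - 1)
        (PainleveV.zLogDeriv (PainleveV.genLaguerre m ((n : ℤ) + k).toNat (-(k : ℂ)))
          + RatFunc.C ((m : ℂ) + 1) * RatFunc.X - RatFunc.C (((m : ℂ) + 1) * n)) ∧
      PainleveV.zLogDeriv (PainleveV.genLaguerreHat m n (k : ℂ))
          - RatFunc.C (((m : ℂ) + 1) * n)
        ≠ PainleveV.zLogDeriv (PainleveV.genLaguerre m ((n : ℤ) + k).toNat (-(k : ℂ)))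
          + RatFunc.C ((m : ℂ) + 1) * RatFunc.X - RatFunc.C (((m : ℂ) + 1) * n)) := by
  obtain ⟨l, hl⟩ : ∃ l : ℕ, ((n : ℤ) + k).toNat = l := ⟨_, rfl⟩
  have hlk : (l : ℂ) = n + k := by
    have : (l : ℤ) = n + k := by omega
    exact_mod_cast congrArg (Int.cast : ℤ → ℂ) this
  rw [hl]
  have hm : (m : ℂ) + 1 ≠ 0 := by exact_mod_cast m.succ_ne_zero
  refine ⟨⟨PainleveV.genLaguerre_ne_zero _ _ _, PainleveV.genLaguerreHat_ne_zero _ _ _,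
    PainleveV.isRationalSolutionSV_genLaguerre m n k, ?_, ?_⟩,
    PainleveV.genLaguerreHat_ne_zero _ _ _, PainleveV.genLaguerre_ne_zero _ _ _, ?_, ?_, ?_⟩
  -- As `l = n + k`, the shift takes `(-(m+1), l, -(m+n+1))` to `(m+1, -n, m+n+k+1)`.
  · have h := (PainleveV.isRationalSolutionSV_genLaguerreHat m l (-(k : ℂ))).shift
    rw [hlk] at h
    convert h using 1
    · ring
    · ring
    · ring
    · simp only [map_add, map_sub, map_mul, map_neg]
      ring
  · intro h
    apply PainleveV.zLogDeriv_sub_ne (PainleveV.genLaguerre_ne_zero m n k)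
      (PainleveV.genLaguerreHat_ne_zero m l (-(k : ℂ))) hm
    linear_combination h
  · convert PainleveV.isRationalSolutionSV_genLaguerreHat m n k using 1 <;> ring
  · have h := (PainleveV.isRationalSolutionSV_genLaguerre m l (-(k : ℂ))).shift
    rw [hlk] at h
    convert h using 1
    · ring
    · ring
    · ring
    · simp only [map_add, map_sub, map_mul, map_neg]
      ring
  · intro h
    apply PainleveV.zLogDeriv_sub_ne (PainleveV.genLaguerreHat_ne_zero m n k)
      (PainleveV.genLaguerre_ne_zero m l (-(k : ℂ))) (neg_ne_zero.mpr hm)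
    rw [map_neg]
    linear_combination h
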